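/- Let $\mathbb{T}_d$ be the rooted $d$-regular tree. A *factor* on $\mathbb{T}_d$ is a Borel measurable function $f:[0,1]^{\mathbb{T}_d}\to\{0,1\}$ that is invariant under all root preserving automorphisms of $\mathbb{T}_d$, where an automorphism $\phi$ acts on labellings by $(\phi\cdot x)(v)=x(\phi^{-1}(v))$. It assigns to a labelling $x$ the vertex set $I_f(x)$ that contains $v$ if and only if $f(\phi_v\cdot x)=1$, where $\phi_v$ is any automorphism of $\mathbb{T}_d$ mapping $v$ to the root. If the coordinates of $X$ are i.i.d. uniform on $[0,1]$ and $I_f(X)$ is almost surely an independent set of $\mathbb{T}_d$, then $I_f(X)$ is called a factor of i.i.d. independent set. For every $d$ let $f_d$ be a factor on $\mathbb{T}_d$ that generates a factor of i.i.d. independent set. For $p\in[0,1]$ let $S$ be the random set of vertices of $\mathbb{T}_d$ that contains every vertex independently with probability $p$, and let $X_0,X_1,X_2,\dots$ be labellings of $\mathbb{T}_d$ with i.i.d. uniform $[0,1]$ coordinates, independent of each other and of $S$. For $i\ge 1$ let $I_{d,i}$ be the independent set generated by $f_d$ from the labelling that equals $X_0(v)$ for $v\notin S$ and $X_i(v)$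 for $v\in S$. For $d\ge 2$ and $i\ge 1$ define $\alpha_{i,d,p}$ by $$\alpha_{i,d,p}\,\frac{\log d}{d}=\mathbb{P}\big(\mathrm{root}\in I_{d,1}\cap\dots\cap I_{d,i}\big).$$ **Theorem.** For each $k\ge 1$, $$\liminf_{d\to\infty}\ \inf_{p\in[0,1]}\ \sum_{i=1}^{k}(-1)^{i-1}\binom{k}{i}\,\alpha_{i,d,p}\,(2-\alpha_{i,d,p})\ \ge\ 0 .$$ -/

import Mathlib

open MeasureTheory ProbabilityTheory Filter

noncomputable section

namespace FIID

/-- Vertices of the `d`-regular tree `𝕋_d`: words over `d` letters in which no two consecutive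
letters agree.  The word records the edge colours met on the way from the root. -/
abbrev Vertex (d : ℕ) : Type := {w : List (Fin d) // w.IsChain (· ≠ ·)}

/-- The root of `𝕋_d` is the empty word. -/
def root (d : ℕ) : Vertex d := ⟨[], List.isChain_nil⟩

/-- The `d`-regular tree `𝕋_d`: two words are adjacent when one of them is obtained from the other
by appending one letter. -/
def tree (d : ℕ) : SimpleGraph (Vertex d) where
  Adj v w := (∃ a, w.1 = v.1 ++ [a]) ∨ (∃ a, v.1 = w.1 ++ [a])
  symm := ⟨fun _ _ h => h.symm⟩
  loopless := ⟨fun v h => by rcases h with ⟨a, h⟩ | ⟨a, h⟩ <;> simp at h⟩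

/-- Labellings `x ∈ [0,1]^{𝕋_d}`, with the product (Borel) `σ`-algebra. -/
abbrev Labelling (d : ℕ) : Type := Vertex d → unitInterval

/-- The action of a graph automorphism on labellings: `(φ · x)(v) = x (φ⁻¹ v)`. -/
def relabel {d : ℕ} (φ : tree d ≃g tree d) (x : Labelling d) : Labelling d :=
  fun v => x (φ.symm v)

/-- The law of a random labelling: i.i.d. uniform labels on `[0,1]`. -/
def labelLaw (d : ℕ) : Measure (Labelling d) :=
  Measure.infinitePi fun _ : Vertex d => (volume : Measure unitInterval)

/-- A factor on `𝕋_d`: a measurable `{0,1}`-valued function of the labelling that is invariant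
under all root preserving automorphisms. -/
structure IsFactor {d : ℕ} (f : Labelling d → Bool) : Prop where
  measurable : Measurable f
  invariant : ∀ φ : tree d ≃g tree d, φ (root d) = root d → ∀ x, f (relabel φ x) = f x

/-- The set `I` produced by a factor `f` from the labelling `x`: `v ∈ I` if and only if
`f (φ · x) = 1`, where `φ` is an automorphism that maps `v` to the root.  Such a `φ` exists, and
for a factor `f` the value does not depend on it, see `mem_process_iff`. -/
def process {d : ℕ} (f : Labelling d → Bool) (x : Labelling d) : Set (Vertex d) :=
  {v | ∃ φ : tree d ≃g tree d, φ v = root d ∧ f (relabel φ x) = true}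

/-- `f` is a factor whose process is almost surely an independent set of `𝕋_d`. -/
structure IsIndepFactor {d : ℕ} (f : Labelling d → Bool) : Prop extends IsFactor f where
  indep : ∀ᵐ x ∂labelLaw d, (tree d).IsIndepSet (process f x)

/-- The randomness behind the correlated copies: independent random labellings `X₀, X₁, X₂, …`
and, independent of them, a Bernoulli percolation `S` of density `p` on the vertices. -/
def couplingLaw (d : ℕ) (p : unitInterval) : Measure ((ℕ → Labelling d) × Set (Vertex d)) :=
  (Measure.infinitePi fun _ : ℕ => labelLaw d).prod (setBernoulli Set.univ p)

open Classical in
/-- The labelling of the `i`-th copy: `X₀` off `S` and `Xᵢ` on `S`. -/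
def copyLabelling {d : ℕ} (ω : (ℕ → Labelling d) × Set (Vertex d)) (i : ℕ) : Labelling d :=
  fun v => if v ∈ ω.2 then ω.1 i v else ω.1 0 v

/-- The `i`-th correlated copy `I_{d,i}`. -/
def copy {d : ℕ} (f : Labelling d → Bool) (ω : (ℕ → Labelling d) × Set (Vertex d)) (i : ℕ) :
    Set (Vertex d) :=
  process f (copyLabelling ω i)

/-- The density of `I_{d,1} ∩ ⋯ ∩ I_{d,i}`: the probability that it contains the root. -/
def interDensity {d : ℕ} (f : Labelling d → Bool) (p : unitInterval) (i : ℕ) : ℝ :=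
  (couplingLaw d p).real {ω | root d ∈ ⋂ j ∈ Finset.Icc 1 i, copy f ω j}

/-- The normalized intersection density `α_{i,d,p}`, so that `α_{i,d,p} (log d)/d` is the density
of the intersection of `i` copies (for `d ≥ 2`). -/
def alpha {d : ℕ} (f : Labelling d → Bool) (p : unitInterval) (i : ℕ) : ℝ :=
  interDensity f p i / (Real.log d / d)

/-! `𝕋_d` is a vertex transitive `d`-regular tree, so that `process` is well defined. -/

/-- The map underlying the reflection of `𝕋_d` in the edge from the root to the word `[a]`. -/
def flipFun {d : ℕ} (a : Fin d) : Vertex d → Vertex d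
  | ⟨[], _⟩ => ⟨[a], List.isChain_singleton _⟩
  | ⟨b :: t, h⟩ => if hb : b = a then ⟨t, h.tail⟩ else
      ⟨a :: b :: t, List.isChain_cons_cons.2 ⟨Ne.symm hb, h⟩⟩

theorem flipFun_flipFun {d : ℕ} (a : Fin d) (v : Vertex d) : flipFun a (flipFun a v) = v := by
  obtain ⟨l, h⟩ := v
  match l, h with
  | [], _ => simp [flipFun]
  | b :: t, h =>
    by_cases hb : b = a
    · subst hb
      match t, h with
      | [], _ => simp [flipFun]
      | c :: t, h =>
        have : c ≠ b := ((List.isChain_cons_cons.1 h).1).symm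
        simp [flipFun, this]
    · simp [flipFun, hb]

theorem flipFun_adj {d : ℕ} (a : Fin d) {v w : Vertex d} (h : (tree d).Adj v w) :
    (tree d).Adj (flipFun a v) (flipFun a w) := by
  have key : ∀ v w : Vertex d, (∃ c, w.1 = v.1 ++ [c]) →
      (tree d).Adj (flipFun a v) (flipFun a w) := by
    rintro ⟨l, h⟩ ⟨l', h'⟩ ⟨c, hc⟩
    dsimp only at hc
    subst hc
    match l, h with
    | [], _ =>
      by_cases hc : c = a
      · subst hc; right; exact ⟨c, by simp [flipFun]⟩
      · left; exact ⟨c, by simp [flipFun, hc]⟩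
    | b :: t, h =>
      by_cases hb : b = a
      · left; exact ⟨c, by simp [flipFun, hb]⟩
      · left; exact ⟨c, by simp [flipFun, hb]⟩
  rcases h with h | h
  · exact key v w h
  · exact (key w v h).symm

/-- The reflection of `𝕋_d` in the edge from the root to the word `[a]`. -/
def edgeFlip {d : ℕ} (a : Fin d) : tree d ≃g tree d where
  toFun := flipFun a
  invFun := flipFun a
  left_inv := flipFun_flipFun a
  right_inv := flipFun_flipFun a
  map_rel_iff' := by
    intro v w
    refine ⟨fun h => ?_, flipFun_adj a⟩
    have := flipFun_adj a h
    simpa [flipFun_flipFun] using this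

theorem edgeFlip_apply {d : ℕ} (a : Fin d) (v : Vertex d) : edgeFlip a v = flipFun a v := rfl

theorem exists_map_root {d : ℕ} (v : Vertex d) : ∃ φ : tree d ≃g tree d, φ v = root d := by
  obtain ⟨l, h⟩ := v
  induction l with
  | nil => exact ⟨SimpleGraph.Iso.refl, rfl⟩
  | cons a t ih =>
    obtain ⟨φ, hφ⟩ := ih h.tail
    refine ⟨(edgeFlip a).trans φ, ?_⟩
    have : edgeFlip a (⟨a :: t, h⟩ : Vertex d) = ⟨t, h.tail⟩ := by
      rw [edgeFlip_apply]
      simp [flipFun]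
    rw [RelIso.trans_apply, this, hφ]

theorem mem_process_iff {d : ℕ} {f : Labelling d → Bool} (hf : IsFactor f) {v : Vertex d}
    (φ : tree d ≃g tree d) (hφ : φ v = root d) (x : Labelling d) :
    v ∈ process f x ↔ f (relabel φ x) = true := by
  refine ⟨?_, fun h => ⟨φ, hφ, h⟩⟩
  rintro ⟨ψ, hψ, h⟩
  have := hf.invariant (ψ.symm.trans φ)
    (by change φ (ψ.symm (root d)) = _; rw [← hψ, RelIso.symm_apply_apply, hψ, hφ]) (relabel ψ x)
  rw [← h, ← this]
  congr 1
  funext u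
  change x (φ.symm u) = x (ψ.symm (ψ (φ.symm u)))
  simp

theorem tree_isTree (d : ℕ) : (tree d).IsTree := by
  have hr : ∀ (l : List (Fin d)) (h : l.IsChain (· ≠ ·)),
      (tree d).Reachable (root d) ⟨l, h⟩ := by
    intro l
    induction l using List.reverseRecOn with
    | nil => exact fun _ => SimpleGraph.Reachable.refl _
    | append_singleton t a ih =>
      intro h
      have ht : t.IsChain (· ≠ ·) := h.left_of_append
      exact (ih ht).trans (SimpleGraph.Adj.reachable (Or.inl ⟨a, rfl⟩))
  have : Nonempty (Vertex d) := ⟨root d⟩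
  refine ⟨⟨fun v w => (hr v.1 v.2).symm.trans (hr w.1 w.2)⟩, ?_⟩
  have key : ∀ (v w : Vertex d) (a : Fin d), w.1 = v.1 ++ [a] → (tree d).IsBridge s(w, v) := by
    intro v w a hw
    rw [SimpleGraph.isBridge_iff]
    rintro ⟨p⟩
    have : ∀ (u u' : Vertex d) (q : ((tree d).deleteEdges {s(w, v)}).Walk u u'),
        w.1 <+: u.1 → w.1 <+: u'.1 := by
      intro u u' q
      induction q with
      | nil => exact id
      | @cons u₁ u₂ _ hadj _ ih =>
        intro hu
        apply ih
        rw [SimpleGraph.deleteEdges_adj] at hadj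
        obtain ⟨hadj, hne⟩ := hadj
        rcases hadj with ⟨c, hc⟩ | ⟨c, hc⟩
        · rw [hc]; exact hu.trans (List.prefix_append _ _)
        · rw [hc, List.prefix_concat_iff] at hu
          rcases hu with hu | hu
          · exfalso
            apply hne
            have h1 : u₁ = w := Subtype.ext (hc.trans hu.symm)
            have h2 : u₂ = v := Subtype.ext (by
              rw [hw] at hu
              exact (List.append_inj_left' hu rfl).symm)
            rw [h1, h2]; rfl
          · exact hu
    have h1 := (this _ _ p List.prefix_rfl).length_le
    rw [hw] at h1
    simp at h1
  rw [SimpleGraph.isAcyclic_iff_forall_isBridge]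
  intro e
  induction e with
  | _ v w =>
    intro h
    rcases h with ⟨a, h⟩ | ⟨a, h⟩
    · rw [Sym2.eq_swap]; exact key v w a h
    · exact key w v a h

theorem tree_ncard_neighborSet {d : ℕ} (v : Vertex d) : ((tree d).neighborSet v).ncard = d := by
  obtain ⟨φ, hφ⟩ := exists_map_root v
  have h1 : ((tree d).neighborSet v).ncard = ((tree d).neighborSet (root d)).ncard := by
    rw [← hφ, ← Nat.card_coe_set_eq, ← Nat.card_coe_set_eq]
    exact Nat.card_congr (φ.mapNeighborSet v)
  have h2 : (tree d).neighborSet (root d) =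
      Set.range fun a : Fin d => (⟨[a], List.isChain_singleton _⟩ : Vertex d) := by
    ext w
    simp only [SimpleGraph.mem_neighborSet, Set.mem_range]
    constructor
    · rintro (⟨a, h⟩ | ⟨a, h⟩)
      · exact ⟨a, Subtype.ext (by simpa [root] using h.symm)⟩
      · simp [root] at h
    · rintro ⟨a, rfl⟩
      exact Or.inl ⟨a, rfl⟩
  rw [h1, h2, ← Nat.card_coe_set_eq, Nat.card_range_of_injective, Nat.card_fin]
  intro a b h
  simpa using congrArg Subtype.val h

end FIID

end

/-!
Grouping the randomness of the coupling by vertices makes it an i.i.d. process on the tree, and the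
set `F` of those of the first `k` copies that contain the root becomes a finitely valued factor of
it. The sets seen from the two ends of an edge are almost surely disjoint.

Write `H(F)` for the entropy of `F` and `H(F, F ∘ τ)` for that of the pair seen from the two ends
of an edge, `τ` being the reflection in it. The edge-vertex inequality
`(2d - 2) H(F) ≤ d H(F, F ∘ τ)` follows by revealing the labels in a random order: the information
gained on `F` at a vertex is gained on the pairs at the `d` edges around the root, and only at the
edge towards that vertex can the gains of the two ends overlap. Conversely, Gibbs' inequality
against the product law restricted to the disjoint pairs bounds `H(F, F ∘ τ)` by `2 H(F)` minus the
probability that two independent copies of `F` intersect; hence `d` times that probability is at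
most `2 H(F)`.

With `P(F = S) = β_S (log d) / d`, the leading order of `H(F)` is `(log d)² / d` times the sum of
`β_S` over `S ≠ ∅`, so that `2 ∑ β_S - ∑ β_S β_T`, over nonempty `S` and over intersecting pairs
`(S, T)`, is at least `-O(1 / log d)`. By inclusion–exclusion this difference is the alternating sum
of the theorem.
-/

noncomputable section

namespace FIID

section Entropy

theorem negMulLog_le_sub_mul_log {p q : ℝ} (hp : 0 ≤ p) (hq : 0 ≤ q) (hpq : q = 0 → p = 0) :
    Real.negMulLog p ≤ q - p - p * Real.log q := by
  rcases hp.eq_or_lt with rfl | hp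
  · simpa using hq
  · have hq : 0 < q := hq.lt_of_ne fun h => hp.ne' (hpq h.symm)
    have h := mul_le_mul_of_nonneg_left (Real.log_le_sub_one_of_pos (div_pos hq hp)) hp.le
    rw [Real.log_div hq.ne' hp.ne', mul_sub, mul_sub, mul_div_cancel₀ _ hp.ne'] at h
    rw [Real.negMulLog]
    linarith

theorem mul_log_mul_div {p u v w : ℝ} (h : p = 0 ∨ 0 < u ∧ 0 < v ∧ 0 < w) :
    p * Real.log (u * v / w) = p * Real.log u + p * Real.log v - p * Real.log w := by
  rcases h with rfl | ⟨hu, hv, hw⟩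
  · simp only [zero_mul, add_zero, sub_zero]
  · rw [Real.log_div (by positivity) hw.ne', Real.log_mul hu.ne' hv.ne', mul_sub, mul_add]

variable {Ω Ω' α β γ δ : Type*} [MeasurableSpace Ω] [MeasurableSpace Ω']
  {μ : Measure Ω} {X : Ω → α} {Y : Ω → β} {Z : Ω → γ}

theorem real_preimage_le_comp [IsFiniteMeasure μ] (X : Ω → α) (φ : α → β) (a : α) :
    μ.real (X ⁻¹' {a}) ≤ μ.real ((fun ω => φ (X ω)) ⁻¹' {φ a}) :=
  measureReal_mono fun _ h => congrArg φ h

theorem sum_real_preimage_pair [Fintype α] [MeasurableSpace α] [MeasurableSingletonClass α]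
    [MeasurableSpace β] [MeasurableSingletonClass β] [IsFiniteMeasure μ] (hX : Measurable X)
    (hY : Measurable Y) (b : β) :
    ∑ a, μ.real ((fun ω => (X ω, Y ω)) ⁻¹' {(a, b)}) = μ.real (Y ⁻¹' {b}) := by
  have h := sum_measureReal_preimage_singleton (μ := μ) (f := fun ω => (X ω, Y ω))
    (Finset.univ ×ˢ {b}) fun t _ => hX.prodMk hY (measurableSet_singleton t)
  have hset : (fun ω => (X ω, Y ω)) ⁻¹' (Finset.univ ×ˢ {b} : Finset (α × β)) = Y ⁻¹' {b} := by
    ext ω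
    simp [eq_comm]
  simpa only [Finset.sum_product, Finset.sum_singleton, hset] using h

variable [Fintype α] [Fintype β] [Fintype γ] [Fintype δ]

/-- The Shannon entropy, in nats, of the law of a finitely valued random variable. -/
def entropy (μ : Measure Ω) (X : Ω → α) : ℝ :=
  ∑ a, Real.negMulLog (μ.real (X ⁻¹' {a}))

theorem entropy_of_subsingleton [IsProbabilityMeasure μ] [Subsingleton α] : entropy μ X = 0 := by
  refine Finset.sum_eq_zero fun a _ => ?_
  have : X ⁻¹' {a} = Set.univ := Set.eq_univ_of_forall fun ω => Subsingleton.elim (X ω) a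
  rw [this, probReal_univ, Real.negMulLog_one]

theorem entropy_le_cross_entropy {q : α → ℝ} (hq : ∀ a, 0 ≤ q a)
    (hX : ∀ a, q a = 0 → μ.real (X ⁻¹' {a}) = 0) :
    entropy μ X ≤ ∑ a, q a - ∑ a, μ.real (X ⁻¹' {a}) -
      ∑ a, μ.real (X ⁻¹' {a}) * Real.log (q a) := by
  rw [← Finset.sum_sub_distrib, ← Finset.sum_sub_distrib]
  exact Finset.sum_le_sum fun a _ => negMulLog_le_sub_mul_log measureReal_nonneg (hq a) (hX a)

variable [MeasurableSpace α] [MeasurableSingletonClass α] [MeasurableSpace β]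
  [MeasurableSingletonClass β] [MeasurableSpace γ] [MeasurableSingletonClass γ]
  [MeasurableSpace δ] [MeasurableSingletonClass δ]

theorem entropy_map {μ : Measure Ω'} {π : Ω' → Ω} (hπ : Measurable π) (hX : Measurable X) :
    entropy (μ.map π) X = entropy μ (X ∘ π) := by
  refine Finset.sum_congr rfl fun a _ => ?_
  rw [map_measureReal_apply hπ (hX (measurableSet_singleton a)), Set.preimage_comp]

section FiniteMeasure

variable [IsFiniteMeasure μ]

theorem sum_real_preimage_singleton (hX : Measurable X) :
    ∑ a, μ.real (X ⁻¹' {a}) = μ.real Set.univ := by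
  simpa using sum_measureReal_preimage_singleton (μ := μ) Finset.univ
    fun a _ => hX (measurableSet_singleton a)

theorem entropy_comp_eq {ε : Type*} [Fintype ε] (hX : Measurable X) (φ : α → ε) :
    entropy μ (fun ω => φ (X ω)) =
      -∑ a, μ.real (X ⁻¹' {a}) * Real.log (μ.real ((fun ω => φ (X ω)) ⁻¹' {φ a})) := by
  classical
  rw [← Finset.sum_fiberwise Finset.univ φ, ← Finset.sum_neg_distrib]
  refine Finset.sum_congr rfl fun b _ => ?_
  have hfiber : (fun ω => φ (X ω)) ⁻¹' {b} = X ⁻¹' ({a | φ a = b} : Finset α) := by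
    ext ω
    simp
  calc Real.negMulLog (μ.real ((fun ω => φ (X ω)) ⁻¹' {b}))
      = -((∑ a with φ a = b, μ.real (X ⁻¹' {a})) *
          Real.log (μ.real ((fun ω => φ (X ω)) ⁻¹' {b}))) := by
        rw [sum_measureReal_preimage_singleton _ fun a _ => hX (measurableSet_singleton a),
          ← hfiber, Real.negMulLog, neg_mul]
    _ = _ := by
        rw [Finset.sum_mul]
        exact congrArg _ (Finset.sum_congr rfl fun a ha => by rw [(Finset.mem_filter.1 ha).2])

theorem entropy_congr (hX : Measurable X) (hY : Measurable Y)
    (h : ∀ ω ω', X ω = X ω' ↔ Y ω = Y ω') : entropy μ X = entropy μ Y := by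
  have hXY := entropy_comp_eq (μ := μ) (hX.prodMk hY) Prod.fst
  have hYX := entropy_comp_eq (μ := μ) (hX.prodMk hY) Prod.snd
  refine hXY.trans (Eq.trans ?_ hYX.symm)
  refine congrArg _ (Finset.sum_congr rfl fun t _ => ?_)
  rcases Set.eq_empty_or_nonempty ((fun ω => (X ω, Y ω)) ⁻¹' {t}) with ht | ⟨ω, rfl⟩
  · rw [ht, measureReal_empty, zero_mul, zero_mul]
  · congr 3
    ext ω'
    exact h ω' ω

/-- The conditional mutual information `I(X; Y | Z)`. -/
def condMutualInfo (μ : Measure Ω) (X : Ω → α) (Y : Ω → β) (Z : Ω → γ) : ℝ :=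
  entropy μ (fun ω => (X ω, Z ω)) + entropy μ (fun ω => (Y ω, Z ω)) -
    entropy μ (fun ω => (X ω, Y ω, Z ω)) - entropy μ Z

theorem condMutualInfo_nonneg (hX : Measurable X) (hY : Measurable Y) (hZ : Measurable Z) :
    0 ≤ condMutualInfo μ X Y Z := by
  set W : Ω → α × β × γ := fun ω => (X ω, Y ω, Z ω)
  have hW : Measurable W := hX.prodMk (hY.prodMk hZ)
  set u : α × β × γ → ℝ := fun t => μ.real ((fun ω => (X ω, Z ω)) ⁻¹' {(t.1, t.2.2)}) with hu
  set v : α × β × γ → ℝ := fun t => μ.real ((fun ω => (Y ω, Z ω)) ⁻¹' {t.2}) with hv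
  set w : α × β × γ → ℝ := fun t => μ.real (Z ⁻¹' {t.2.2}) with hw
  have hmass : ∑ t, u t * v t / w t = ∑ t, μ.real (W ⁻¹' {t}) := by
    rw [sum_real_preimage_singleton hW, ← sum_real_preimage_singleton hZ, Fintype.sum_prod_type,
      Finset.sum_comm, Fintype.sum_prod_type_right]
    refine Finset.sum_congr rfl fun c _ => ?_
    simp only [hu, hv, hw, ← Finset.sum_mul, ← Finset.sum_div, ← Finset.mul_sum,
      sum_real_preimage_pair hX hZ, sum_real_preimage_pair hY hZ]
    exact mul_self_div_self _
  have hpos : ∀ t, μ.real (W ⁻¹' {t}) = 0 ∨ 0 < u t ∧ 0 < v t ∧ 0 < w t := fun t =>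
    measureReal_nonneg.eq_or_lt.imp Eq.symm fun h =>
      ⟨h.trans_le (real_preimage_le_comp W (fun t => (t.1, t.2.2)) t),
        h.trans_le (real_preimage_le_comp W (fun t => t.2) t),
        h.trans_le (real_preimage_le_comp W (fun t => t.2.2) t)⟩
  have gibbs := entropy_le_cross_entropy (μ := μ) (X := W) (q := fun t => u t * v t / w t)
    (fun t => by positivity) fun t ht => (hpos t).resolve_right fun ⟨h₁, h₂, h₃⟩ =>
      (by positivity : u t * v t / w t ≠ 0) ht
  simp only [fun t => mul_log_mul_div (hpos t), hmass, sub_self, zero_sub,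
    Finset.sum_sub_distrib, Finset.sum_add_distrib] at gibbs
  rw [condMutualInfo, entropy_comp_eq hW fun t => (t.1, t.2.2), entropy_comp_eq hW fun t => t.2,
    entropy_comp_eq hW fun t => t.2.2]
  linarith

theorem condMutualInfo_comp_le (hX : Measurable X) (hY : Measurable Y) (hZ : Measurable Z)
    (φ : α → δ) : condMutualInfo μ (fun ω => φ (X ω)) Y Z ≤ condMutualInfo μ X Y Z := by
  have hφ : Measurable fun ω => φ (X ω) := (measurable_of_finite φ).comp hX
  have h := condMutualInfo_nonneg (μ := μ) hX hY (hφ.prodMk hZ)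
  have hXZ : entropy μ (fun ω => (X ω, φ (X ω), Z ω)) = entropy μ (fun ω => (X ω, Z ω)) :=
    entropy_congr (by fun_prop) (by fun_prop) (by grind)
  have hYZ : entropy μ (fun ω => (Y ω, φ (X ω), Z ω)) =
      entropy μ (fun ω => (φ (X ω), Y ω, Z ω)) :=
    entropy_congr (by fun_prop) (by fun_prop) (by grind)
  have hXYZ : entropy μ (fun ω => (X ω, Y ω, φ (X ω), Z ω)) =
      entropy μ (fun ω => (X ω, Y ω, Z ω)) :=
    entropy_congr (by fun_prop) (by fun_prop) (by grind)
  rw [condMutualInfo, hXZ, hYZ, hXYZ] at h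
  rw [condMutualInfo, condMutualInfo]
  linarith

end FiniteMeasure

theorem condMutualInfo_map {μ : Measure Ω'} {π : Ω' → Ω} (hπ : Measurable π)
    (hX : Measurable X) (hY : Measurable Y) (hZ : Measurable Z) :
    condMutualInfo (μ.map π) X Y Z = condMutualInfo μ (X ∘ π) (Y ∘ π) (Z ∘ π) := by
  simp only [condMutualInfo, entropy_map hπ hZ, entropy_map hπ (hX.prodMk hZ),
    entropy_map hπ (hY.prodMk hZ), entropy_map hπ (hX.prodMk (hY.prodMk hZ))]
  rfl

variable [IsProbabilityMeasure μ]

/-- The pair is compared with the product of the marginals restricted to the complement of `E`: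
the mass that the product puts on `E` is gained. -/
theorem entropy_pair_le_of_null (hX : Measurable X) (hY : Measurable Y)
    (E : Finset (α × β)) (hE : ∀ t ∈ E, μ.real ((fun ω => (X ω, Y ω)) ⁻¹' {t}) = 0) :
    entropy μ (fun ω => (X ω, Y ω)) ≤ entropy μ X + entropy μ Y -
      ∑ t ∈ E, μ.real (X ⁻¹' {t.1}) * μ.real (Y ⁻¹' {t.2}) := by
  classical
  set W : Ω → α × β := fun ω => (X ω, Y ω)
  have hW : Measurable W := hX.prodMk hY
  set u : α × β → ℝ := fun t => μ.real (X ⁻¹' {t.1}) with hu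
  set v : α × β → ℝ := fun t => μ.real (Y ⁻¹' {t.2}) with hv
  have hmass : ∑ t with t ∉ E, u t * v t = 1 - ∑ t ∈ E, u t * v t := by
    have huv : ∑ t, u t * v t = 1 := by
      simp only [hu, hv, Fintype.sum_prod_type, ← Finset.mul_sum,
        sum_real_preimage_singleton hX, sum_real_preimage_singleton hY, probReal_univ, mul_one]
    rw [← huv, ← Finset.sum_filter_not_add_sum_filter Finset.univ (· ∈ E),
      Finset.filter_mem_eq_inter, Finset.univ_inter, add_sub_cancel_right]
  have hpos : ∀ t, μ.real (W ⁻¹' {t}) = 0 ∨ 0 < u t ∧ 0 < v t ∧ (0 : ℝ) < 1 := fun t =>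
    measureReal_nonneg.eq_or_lt.imp Eq.symm fun h =>
      ⟨h.trans_le (real_preimage_le_comp W Prod.fst t),
        h.trans_le (real_preimage_le_comp W Prod.snd t), one_pos⟩
  have hlog : ∀ t, μ.real (W ⁻¹' {t}) * Real.log (if t ∈ E then 0 else u t * v t) =
      μ.real (W ⁻¹' {t}) * Real.log (u t) + μ.real (W ⁻¹' {t}) * Real.log (v t) := fun t => by
    split_ifs with h
    · simp only [hE t h, zero_mul, add_zero]
    · simpa using mul_log_mul_div (hpos t)
  have gibbs := entropy_le_cross_entropy (μ := μ) (X := W)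
    (q := fun t => if t ∈ E then 0 else u t * v t)
    (fun t => by split_ifs <;> positivity) fun t ht => by
      split_ifs at ht with h
      · exact hE t h
      · exact (hpos t).resolve_right fun ⟨h₁, h₂, _⟩ => (by positivity : u t * v t ≠ 0) ht
  simp only [hlog, Finset.sum_add_distrib] at gibbs
  rw [Finset.sum_ite, Finset.sum_const_zero, zero_add, hmass, sum_real_preimage_singleton hW,
    probReal_univ] at gibbs
  have hX' := entropy_comp_eq (μ := μ) hW Prod.fst
  have hY' := entropy_comp_eq (μ := μ) hW Prod.snd
  linarith

theorem entropy_pair_of_indepFun (hX : Measurable X) (hY : Measurable Y)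
    (h : IndepFun X Y μ) : entropy μ (fun ω => (X ω, Y ω)) = entropy μ X + entropy μ Y := by
  have hprod : ∀ a b, μ.real ((fun ω => (X ω, Y ω)) ⁻¹' {(a, b)}) =
      μ.real (X ⁻¹' {a}) * μ.real (Y ⁻¹' {b}) := fun a b => by
    rw [← Set.singleton_prod_singleton, Set.mk_preimage_prod]
    exact (congrArg ENNReal.toReal (h.measure_inter_preimage_eq_mul _ _ (measurableSet_singleton a)
      (measurableSet_singleton b))).trans ENNReal.toReal_mul
  simp only [entropy, Fintype.sum_prod_type, hprod, Real.negMulLog_mul, Finset.sum_add_distrib,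
    ← Finset.mul_sum, ← Finset.sum_mul, sum_real_preimage_singleton hX,
    sum_real_preimage_singleton hY, probReal_univ, one_mul]

theorem condMutualInfo_eq_zero_of_indepFun (hX : Measurable X)
    (hY : Measurable Y) (hZ : Measurable Z) (h : IndepFun (fun ω => (X ω, Z ω)) Y μ) :
    condMutualInfo μ X Y Z = 0 := by
  have hXYZ : entropy μ (fun ω => (X ω, Y ω, Z ω)) = entropy μ (fun ω => ((X ω, Z ω), Y ω)) :=
    entropy_congr (by fun_prop) (by fun_prop) (by grind)
  have hYZ : entropy μ (fun ω => (Y ω, Z ω)) = entropy μ (fun ω => (Z ω, Y ω)) :=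
    entropy_congr (by fun_prop) (by fun_prop) (by grind)
  rw [condMutualInfo, hXYZ, hYZ, entropy_pair_of_indepFun (hX.prodMk hZ) hY h,
    entropy_pair_of_indepFun hZ hY (h.comp measurable_snd measurable_id)]
  ring

end Entropy

theorem card_sub_one_mul_le_sum_ite {κ : Type*} [Fintype κ] [DecidableEq κ] (o : Option κ) {x : ℝ}
    (hx : 0 ≤ x) : (Fintype.card κ - 1) * x ≤ ∑ a, if o = some a then 0 else x := by
  have hsplit : ∀ a, (if o = some a then 0 else x) = x - if o = some a then x else 0 := fun a => by
    split_ifs <;> simp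
  have hle : ∑ a, (if o = some a then x else 0) ≤ x := by
    cases o <;> simp [hx]
  simp only [hsplit, Finset.sum_sub_distrib, Finset.sum_const, Finset.card_univ, nsmul_eq_mul]
  linarith

/-- Mass transport: `g` sends `δ g` across every `s a` but its parent. If `δ g` and `δ (s a g)` are
both nonzero, at most one of them is sent across `s a`, so the maximum pays for it. -/
theorem mul_sum_le_sum_max {κ G : Type*} [Fintype κ] [Fintype G] {s : κ → G → G}
    (hs : ∀ a, Function.Involutive (s a)) {δ : G → ℝ} (hδ : ∀ g, 0 ≤ δ g) (par : G → Option κ)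
    (hpar : ∀ a g, δ g ≠ 0 → δ (s a g) ≠ 0 → par g = some a ∨ par (s a g) = some a) :
    (2 * Fintype.card κ - 2) * ∑ g, δ g ≤ ∑ a, ∑ g, max (δ g) (δ (s a g)) := by
  classical
  set r : κ → G → ℝ := fun a g => if par g = some a then 0 else δ g with hr
  have hmax : ∀ a g, r a g + r a (s a g) ≤ max (δ g) (δ (s a g)) := by
    intro a g
    have hle : ∀ g, r a g ≤ δ g := fun g => by
      simp only [hr]
      split_ifs
      exacts [hδ g, le_rfl]
    have hzero : r a g ≤ 0 ∨ r a (s a g) ≤ 0 := by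
      by_cases h : δ g = 0
      · exact .inl (h ▸ hle g)
      by_cases h' : δ (s a g) = 0
      · exact .inr (h' ▸ hle _)
      exact (hpar a g h h').imp (fun h => by simp [hr, h]) fun h => by simp [hr, h]
    rcases hzero with h | h
    · exact le_max_of_le_right (by linarith [hle (s a g)])
    · exact le_max_of_le_left (by linarith [hle g])
  calc (2 * Fintype.card κ - 2) * ∑ g, δ g
      = 2 * ∑ g, (Fintype.card κ - 1) * δ g := by rw [← Finset.mul_sum]; ring
    _ ≤ 2 * ∑ g, ∑ a, r a g := by
        gcongr with g
        exact card_sub_one_mul_le_sum_ite (par g) (hδ g)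
    _ = ∑ a, ∑ g, (r a g + r a (s a g)) := by
        rw [Finset.sum_comm, Finset.mul_sum]
        refine Finset.sum_congr rfl fun a _ => ?_
        rw [Finset.sum_add_distrib, (hs a).bijective.sum_comp (r a), two_mul]
    _ ≤ _ := Finset.sum_le_sum fun a _ => Finset.sum_le_sum fun g _ => hmax a g

section FiniteLabels

variable {B Λ α β : Type*} [Fintype B]

/-- The first `m` labels revealed when the sites are visited in the order `e`. -/
def revealed (e : Fin (Fintype.card B) ≃ B) (m : ℕ) (z : B → Λ) :
    {i : Fin (Fintype.card B) // i.val < m} → Λ :=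
  fun i => z (e i)

theorem revealed_eq_iff {e : Fin (Fintype.card B) ≃ B} {m : ℕ} {z z' : B → Λ} :
    revealed e m z = revealed e m z' ↔
      ∀ i : Fin (Fintype.card B), i.val < m → z (e i) = z' (e i) := by
  rw [funext_iff, Subtype.forall]
  rfl

theorem revealed_succ_eq_iff {e : Fin (Fintype.card B) ≃ B} {j : Fin (Fintype.card B)}
    {z z' : B → Λ} : revealed e (j + 1) z = revealed e (j + 1) z' ↔
      z (e j) = z' (e j) ∧ revealed e j z = revealed e j z' := by
  simp only [revealed_eq_iff, Order.lt_add_one_iff, le_iff_eq_or_lt, ← Fin.ext_iff, or_imp,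
    forall_and, forall_eq]

variable [Fintype Λ] [MeasurableSpace Λ] [DiscreteMeasurableSpace Λ]
  [Fintype α] [MeasurableSpace α] [MeasurableSingletonClass α]
  [Fintype β] [MeasurableSpace β] [MeasurableSingletonClass β]

/-- The information on `X` in the `j`-th label, given the labels visited before it in the
order `e`. -/
def infoGain (ν : Measure Λ) (X : (B → Λ) → α) (e : Fin (Fintype.card B) ≃ B)
    (j : Fin (Fintype.card B)) : ℝ :=
  condMutualInfo (Measure.infinitePi fun _ : B => ν) X (fun z => z (e j)) (revealed e j)

variable {ν : Measure Λ} [IsProbabilityMeasure ν]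

theorem sum_infoGain (X : (B → Λ) → α) (e : Fin (Fintype.card B) ≃ B) :
    ∑ j, infoGain ν X e j = entropy (Measure.infinitePi fun _ : B => ν) X := by
  set μ := Measure.infinitePi fun _ : B => ν
  set h : ℕ → ℝ := fun m => entropy μ (fun z => (X z, revealed e m z)) - entropy μ (revealed e m)
    with hh
  have hgain : ∀ j, infoGain ν X e j = h j - h (j + 1) := by
    intro j
    have hpast : entropy μ (fun z => (z (e j), revealed e j z)) = entropy μ (revealed e (j + 1)) :=
      entropy_congr .of_discrete .of_discrete fun z z' => by rw [Prod.ext_iff, revealed_succ_eq_iff]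
    have hpair : entropy μ (fun z => (X z, z (e j), revealed e j z)) =
        entropy μ (fun z => (X z, revealed e (j + 1) z)) :=
      entropy_congr .of_discrete .of_discrete fun z z' => by
        simp only [Prod.ext_iff, revealed_succ_eq_iff]
    rw [infoGain, condMutualInfo, hpast, hpair]
    ring
  have hstart : h 0 = entropy μ X := by
    have : IsEmpty {i : Fin (Fintype.card B) // i.val < 0} := ⟨fun i => i.1.val.not_lt_zero i.2⟩
    have hpair : entropy μ (fun z => (X z, revealed e 0 z)) = entropy μ X :=
      entropy_congr .of_discrete .of_discrete fun z z' => by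
        simp only [Prod.ext_iff, Subsingleton.elim (revealed e 0 z) (revealed e 0 z'), and_true]
    simp only [hh, hpair, entropy_of_subsingleton, sub_zero]
  have hend : h (Fintype.card B) = 0 := by
    refine sub_eq_zero.2 (entropy_congr .of_discrete .of_discrete fun z z' => ?_)
    refine ⟨congrArg Prod.snd, fun hz => ?_⟩
    have : z = z' := funext fun v => by simpa using revealed_eq_iff.1 hz (e.symm v) (Fin.is_lt _)
    rw [this]
  calc ∑ j, infoGain ν X e j = ∑ m ∈ Finset.range (Fintype.card B), (h m - h (m + 1)) := by
        simp only [hgain, Finset.sum_range]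
    _ = entropy μ X := by rw [Finset.sum_range_sub', hstart, hend, sub_zero]

theorem infoGain_comp_perm (X : (B → Λ) → α) (e : Fin (Fintype.card B) ≃ B)
    (j : Fin (Fintype.card B)) (σ : Equiv.Perm B) :
    infoGain ν (fun z => X fun v => z (σ v)) (e.trans σ) j = infoGain ν X e j := by
  have hμ := Measure.map_infinitePi_infinitePi_of_inj (P := fun _ : B => ν) σ.injective
  conv_rhs =>
    rw [infoGain, ← hμ,
      condMutualInfo_map (by fun_prop) .of_discrete .of_discrete .of_discrete]
  rfl

theorem infoGain_nonneg (X : (B → Λ) → α) (e : Fin (Fintype.card B) ≃ B)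
    (j : Fin (Fintype.card B)) : 0 ≤ infoGain ν X e j :=
  condMutualInfo_nonneg .of_discrete .of_discrete .of_discrete

theorem infoGain_comp_le (X : (B → Λ) → α) (φ : α → β) (e : Fin (Fintype.card B) ≃ B)
    (j : Fin (Fintype.card B)) : infoGain ν (fun z => φ (X z)) e j ≤ infoGain ν X e j :=
  condMutualInfo_comp_le .of_discrete .of_discrete .of_discrete φ

theorem max_infoGain_le_infoGain_pair (X : (B → Λ) → α) (e : Fin (Fintype.card B) ≃ B)
    (j : Fin (Fintype.card B)) {σ : B → B} (hσ : Function.Involutive σ) :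
    max (infoGain ν X e j) (infoGain ν X (e.trans hσ.toPerm) j) ≤
      infoGain ν (fun z => (X z, X fun v => z (σ v))) e j := by
  have hshift := infoGain_comp_perm (ν := ν) X (e.trans hσ.toPerm) j hσ.toPerm
  rw [show (e.trans hσ.toPerm).trans hσ.toPerm = e from Equiv.ext fun i => hσ (e i)] at hshift
  exact max_le (infoGain_comp_le (fun z => (X z, X fun v => z (σ v))) Prod.fst e j)
    (hshift.symm.trans_le (infoGain_comp_le (fun z => (X z, X fun v => z (σ v))) Prod.snd e j))

theorem infoGain_eq_zero {X : (B → Λ) → α} {T : Set B} (hX : DependsOn X T)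
    {e : Fin (Fintype.card B) ≃ B} {j : Fin (Fintype.card B)} (hj : e j ∉ T) :
    infoGain ν X e j = 0 := by
  classical
  have : Nonempty Λ := ν.nonempty_of_neZero
  have : Nonempty (α × ({i : Fin (Fintype.card B) // i.val < j} → Λ)) :=
    ⟨(X fun _ => Classical.arbitrary Λ, fun _ => Classical.arbitrary Λ)⟩
  have hdep : DependsOn (fun z => (X z, revealed e j z)) (({e j}ᶜ : Finset B) : Set B) := by
    intro z z' hz
    simp only [Finset.coe_compl, Finset.coe_singleton, Set.mem_compl_iff,
      Set.mem_singleton_iff] at hz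
    refine Prod.ext (hX fun v hv => hz v fun h => hj (h ▸ hv)) (revealed_eq_iff.2 fun i hi => ?_)
    exact hz _ fun h => hi.ne (congrArg Fin.val (e.injective h))
  obtain ⟨φ, hφ⟩ := dependsOn_iff_exists_comp.1 hdep
  have hind := (iIndepFun_infinitePi (P := fun _ : B => ν) (X := fun _ => id)
    fun _ => measurable_id).indepFun_finset {e j}ᶜ {e j} disjoint_compl_left
    fun v => measurable_pi_apply v
  refine condMutualInfo_eq_zero_of_indepFun .of_discrete .of_discrete .of_discrete ?_
  rw [hφ]
  exact hind.comp (φ := φ) (ψ := fun y => y ⟨e j, Finset.mem_singleton_self _⟩) .of_discrete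
    .of_discrete

end FiniteLabels

/-- The entropies are averaged over all orders in which the labels can be revealed. The label at `v`
informs on both entries of the pair of `a` only if `v` and `σ a v` lie in `T`, where `c` guarantees
that one of the two gains is not needed. -/
theorem edge_vertex_entropy_le_of_dependsOn {B Λ α κ : Type*} [Finite B] [Finite Λ]
    [MeasurableSpace Λ] [DiscreteMeasurableSpace Λ] [Fintype α] [MeasurableSpace α]
    [MeasurableSingletonClass α] [Fintype κ] {ν : Measure Λ} [IsProbabilityMeasure ν]
    {σ : κ → B → B} (hσ : ∀ a, Function.Involutive (σ a)) {X : (B → Λ) → α} {T : Set B}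
    (hX : DependsOn X T) {c : B → Option κ}
    (hc : ∀ a, ∀ v ∈ T, σ a v ∈ T → c v = some a ∨ c (σ a v) = some a) :
    (2 * Fintype.card κ - 2) * entropy (Measure.infinitePi fun _ : B => ν) X ≤
      ∑ a, entropy (Measure.infinitePi fun _ : B => ν) fun z => (X z, X fun v => z (σ a v)) := by
  classical
  have := Fintype.ofFinite B
  have := Fintype.ofFinite Λ
  set Order := Fin (Fintype.card B) ≃ B
  set s : κ → Order × Fin (Fintype.card B) → Order × Fin (Fintype.card B) :=
    fun a g => (g.1.trans (hσ a).toPerm, g.2)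
  have hs : ∀ a, Function.Involutive (s a) := fun a g =>
    Prod.ext (Equiv.ext fun i => hσ a (g.1 i)) rfl
  have hpair : ∀ a g, max (infoGain ν X g.1 g.2) (infoGain ν X (s a g).1 (s a g).2) ≤
      infoGain ν (fun z => (X z, X fun v => z (σ a v))) g.1 g.2 := fun a g =>
    max_infoGain_le_infoGain_pair X g.1 g.2 (hσ a)
  have transport := mul_sum_le_sum_max hs (δ := fun g => infoGain ν X g.1 g.2)
    (fun g => infoGain_nonneg X g.1 g.2) (fun g => c (g.1 g.2)) fun a g h h' =>
      hc a (g.1 g.2) (by_contra fun hT => h (infoGain_eq_zero hX hT))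
        (by_contra fun hT => h' (infoGain_eq_zero (e := (s a g).1) hX hT))
  have hcard : (0 : ℝ) < Fintype.card Order :=
    Nat.cast_pos.2 (Fintype.card_pos_iff.2 ⟨(Fintype.equivFin B).symm⟩)
  refine le_of_mul_le_mul_left ?_ hcard
  calc _ = (2 * Fintype.card κ - 2) *
          ∑ g : Order × Fin (Fintype.card B), infoGain ν X g.1 g.2 := by
        rw [Fintype.sum_prod_type]
        simp only [sum_infoGain, Finset.sum_const, Finset.card_univ, nsmul_eq_mul]
        ring
    _ ≤ _ := transport
    _ ≤ ∑ a, ∑ g : Order × Fin (Fintype.card B),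
          infoGain ν (fun z => (X z, X fun v => z (σ a v))) g.1 g.2 :=
        Finset.sum_le_sum fun a _ => Finset.sum_le_sum fun g _ => hpair a g
    _ = _ := by
        simp only [Fintype.sum_prod_type, sum_infoGain, Finset.sum_const, Finset.card_univ,
          nsmul_eq_mul, Finset.mul_sum]

section Quantized

variable {ι Λ α β : Type*} [MeasurableSpace Λ]

/-- `F` depends only on a finitely valued measurable function of the labels at finitely many
sites. -/
def IsQuantized (F : (ι → Λ) → α) : Prop :=
  ∃ (s : Finset ι) (m : ℕ) (q : Λ → Fin m), Measurable q ∧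
    F.FactorsThrough fun x (v : s) => q (x v)

theorem IsQuantized.comp {F : (ι → Λ) → α} (hF : IsQuantized F) (φ : α → β) :
    IsQuantized fun x => φ (F x) := by
  obtain ⟨s, m, q, hq, h⟩ := hF
  exact ⟨s, m, q, hq, fun x y hxy => congrArg φ (h hxy)⟩

theorem IsQuantized.const (c : α) : IsQuantized fun _ : ι → Λ => c :=
  ⟨∅, 1, fun _ => 0, measurable_const, fun _ _ _ => rfl⟩

theorem IsQuantized.pi {κ : Type*} [Finite κ] {F : κ → (ι → Λ) → α}
    (hF : ∀ i, IsQuantized (F i)) : IsQuantized fun x i => F i x := by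
  classical
  have := Fintype.ofFinite κ
  choose s m q hq h using hF
  refine ⟨Finset.univ.biUnion s, _, fun x => Fintype.equivFin (∀ i, Fin (m i)) fun i => q i x,
    (measurable_of_finite _).comp (measurable_pi_iff.2 hq), fun x y hxy => funext fun i => ?_⟩
  refine h i (funext fun v => ?_)
  have hv : v.1 ∈ Finset.univ.biUnion s := Finset.mem_biUnion.2 ⟨i, Finset.mem_univ i, v.2⟩
  exact congrFun ((Fintype.equivFin _).injective (congrFun hxy ⟨v, hv⟩)) i

theorem IsQuantized.measurable [MeasurableSpace α] {F : (ι → Λ) → α} (hF : IsQuantized F) :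
    Measurable F := by
  obtain ⟨s, m, q, hq, h⟩ := hF
  rcases isEmpty_or_nonempty α with _ | _
  · exact measurable_of_subsingleton_codomain F
  · obtain ⟨G, rfl⟩ := (Function.factorsThrough_iff F).1 h
    exact Measurable.comp .of_discrete (by fun_prop)

theorem isSetRing_quantized : IsSetRing {E : Set (ι → Λ) | IsQuantized (· ∈ E)} := by
  have hpair : ∀ {s t : Set (ι → Λ)}, IsQuantized (· ∈ s) → IsQuantized (· ∈ t) →
      IsQuantized fun x (b : Bool) => x ∈ cond b s t := fun hs ht =>
    .pi fun b => b.casesOn ht hs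
  exact
    { empty_mem := .const False
      union_mem := fun s t hs ht => (hpair hs ht).comp fun u => u true ∨ u false
      sdiff_mem := fun s t hs ht => (hpair hs ht).comp fun u => u true ∧ ¬ u false }

theorem generateFrom_quantized : (inferInstance : MeasurableSpace (ι → Λ)) =
    MeasurableSpace.generateFrom {E : Set (ι → Λ) | IsQuantized (· ∈ E)} := by
  classical
  refine le_antisymm (iSup_le fun v => ?_) (MeasurableSpace.generateFrom_le fun E hE => ?_)
  · rintro _ ⟨B, hB, rfl⟩
    refine MeasurableSpace.measurableSet_generateFrom
      ⟨{v}, 2, fun c => if c ∈ B then 0 else 1, .ite hB measurable_const measurable_const,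
        fun x y hxy => propext ?_⟩
    have := congrFun hxy ⟨v, Finset.mem_singleton_self v⟩
    by_cases hx : x v ∈ B <;> by_cases hy : y v ∈ B <;> simp_all
  · exact measurableSet_setOfPred.2 (IsQuantized.measurable hE)

variable [Finite α] [MeasurableSpace α] [MeasurableSingletonClass α] {ν : Measure Λ}
  [IsProbabilityMeasure ν]

theorem exists_isQuantized_measureReal_ne_le {F : (ι → Λ) → α} (hF : Measurable F) {ε : ℝ}
    (hε : 0 < ε) : ∃ F' : (ι → Λ) → α, IsQuantized F' ∧
      (Measure.infinitePi fun _ : ι => ν).real {x | F x ≠ F' x} ≤ ε := by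
  classical
  have := Fintype.ofFinite α
  set μ := Measure.infinitePi fun _ : ι => ν
  have : Nonempty α := μ.nonempty_of_neZero.map F
  have hδ : 0 < ε / Fintype.card α := div_pos hε (Nat.cast_pos.2 Fintype.card_pos)
  have happrox : ∀ a, ∃ A, IsQuantized (· ∈ A) ∧
      μ (symmDiff A (F ⁻¹' {a})) < ENNReal.ofReal (ε / Fintype.card α) := fun a =>
    exists_measure_symmDiff_lt_of_generateFrom_isSetRing isSetRing_quantized
      ⟨{Set.univ}, Set.countable_singleton _, by simpa using IsQuantized.const True, by simp⟩
      generateFrom_quantized (hF (measurableSet_singleton a)) (ENNReal.ofReal_pos.2 hδ)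
  choose A hA hμ using happrox
  set φ : (α → Prop) → α := fun u => if h : ∃ a, u a then h.choose else Classical.arbitrary α
  have hφ : ∀ b, φ (b = ·) = b := fun b => by
    have h : ∃ a, b = a := ⟨b, rfl⟩
    simp only [φ, dif_pos h, ← h.choose_spec]
  refine ⟨fun x => φ fun a => x ∈ A a, (IsQuantized.pi hA).comp φ, ?_⟩
  have hsub : {x | F x ≠ φ fun a => x ∈ A a} ⊆ ⋃ a ∈ Finset.univ, symmDiff (A a) (F ⁻¹' {a}) := by
    intro x hx
    by_contra hnot
    simp only [Finset.mem_univ, Set.iUnion_true, Set.mem_iUnion, not_exists, Set.mem_symmDiff,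
      Set.mem_preimage, Set.mem_singleton_iff] at hnot
    have hiff : (fun a => x ∈ A a) = (F x = ·) := by
      ext a
      have := hnot a
      tauto
    exact hx (by rw [hiff, hφ])
  calc μ.real {x | F x ≠ φ fun a => x ∈ A a}
      ≤ ∑ a, μ.real (symmDiff (A a) (F ⁻¹' {a})) :=
        (measureReal_mono hsub (measure_ne_top _ _)).trans (measureReal_biUnion_finset_le _ _)
    _ ≤ ∑ _a : α, ε / Fintype.card α :=
        Finset.sum_le_sum fun a _ => ENNReal.toReal_le_of_le_ofReal hδ.le (hμ a).le
    _ = ε := by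
        rw [Finset.sum_const, Finset.card_univ, nsmul_eq_mul,
          mul_div_cancel₀ _ (Nat.cast_ne_zero.2 Fintype.card_ne_zero)]

end Quantized

section EntropyLimit

variable {Ω α : Type*} [MeasurableSpace Ω] {μ : Measure Ω} [IsFiniteMeasure μ]

theorem abs_real_preimage_sub_le (X Y : Ω → α) (s : Set α) :
    |μ.real (X ⁻¹' s) - μ.real (Y ⁻¹' s)| ≤ μ.real {ω | X ω ≠ Y ω} := by
  have hle : ∀ X Y : Ω → α, μ.real (X ⁻¹' s) ≤ μ.real (Y ⁻¹' s) + μ.real {ω | X ω ≠ Y ω} := by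
    intro X Y
    refine (measureReal_mono fun ω hω => ?_).trans (measureReal_union_le _ _)
    refine or_iff_not_imp_right.2 fun h => ?_
    rwa [Set.mem_preimage, ← not_not.1 h]
  have hXY := hle X Y
  have hYX := hle Y X
  simp only [ne_comm (a := Y _)] at hYX
  rw [abs_le]
  constructor <;> linarith

theorem tendsto_entropy [Fintype α] {X : Ω → α} {Y : ℕ → Ω → α}
    (h : Tendsto (fun n => μ.real {ω | X ω ≠ Y n ω}) atTop (nhds 0)) :
    Tendsto (fun n => entropy μ (Y n)) atTop (nhds (entropy μ X)) := by
  refine tendsto_finsetSum _ fun a _ => (Real.continuous_negMulLog.tendsto _).comp ?_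
  rw [tendsto_iff_norm_sub_tendsto_zero]
  refine squeeze_zero (fun _ => norm_nonneg _) (fun n => ?_) h
  rw [norm_sub_rev]
  exact abs_real_preimage_sub_le X (Y n) {a}

end EntropyLimit

section EdgeVertex

theorem measurePreserving_infinitePi_comp {ι Λ : Type*} [MeasurableSpace Λ] (ν : Measure Λ)
    [IsProbabilityMeasure ν] {τ : ι → ι} (hτ : Function.Injective τ) :
    MeasurePreserving (fun (x : ι → Λ) v => x (τ v)) (Measure.infinitePi fun _ => ν)
      (Measure.infinitePi fun _ => ν) :=
  ⟨by fun_prop, Measure.map_infinitePi_infinitePi_of_inj (P := fun _ : ι => ν) hτ⟩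

variable {ι κ Λ α : Type*} [Fintype κ] [MeasurableSpace Λ] [Fintype α] [MeasurableSpace α]
  [MeasurableSingletonClass α] {ν : Measure Λ} [IsProbabilityMeasure ν] {τ : κ → ι → ι}
  {c : ι → Option κ}

/-- Only the finitely many sites in the support of `F` and in its images under the `τ a` matter.
The involutions act on them once they are set to fix every site that they would move away. -/
theorem IsQuantized.edge_vertex_entropy_le (hτ : ∀ a, Function.Involutive (τ a))
    (hc : ∀ a v, c v = some a ∨ c (τ a v) = some a) {F : (ι → Λ) → α} (hF : IsQuantized F) :
    (2 * Fintype.card κ - 2) * entropy (Measure.infinitePi fun _ : ι => ν) F ≤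
      ∑ a, entropy (Measure.infinitePi fun _ : ι => ν) fun x => (F x, F fun v => x (τ a v)) := by
  classical
  have : Nonempty α := (Measure.infinitePi fun _ : ι => ν).nonempty_of_neZero.map F
  obtain ⟨s, m, q, hq, hfactors⟩ := hF
  obtain ⟨G, rfl⟩ := (Function.factorsThrough_iff F).1 hfactors
  have := Measure.isProbabilityMeasure_map (μ := ν) hq.aemeasurable
  set B : Finset ι := s ∪ Finset.univ.biUnion fun a => s.image (τ a)
  have hsB : ∀ v ∈ s, v ∈ B := fun v hv => Finset.mem_union_left _ hv
  have hτB : ∀ a, ∀ v ∈ s, τ a v ∈ B := fun a v hv => Finset.mem_union_right _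
    (Finset.mem_biUnion.2 ⟨a, Finset.mem_univ a, Finset.mem_image_of_mem _ hv⟩)
  set σ : κ → B → B := fun a v => if h : τ a v ∈ B then ⟨τ a v, h⟩ else v with hσdef
  have hσ : ∀ a, Function.Involutive (σ a) := fun a v => by
    by_cases h : τ a v ∈ B
    · simp only [hσdef, dif_pos h, hτ a v.1, v.2, dite_true]
    · simp only [hσdef, dif_neg h]
  have hστ : ∀ a, ∀ v (hv : v ∈ s), σ a ⟨v, hsB v hv⟩ = ⟨τ a v, hτB a v hv⟩ := fun a v hv =>
    dif_pos (hτB a v hv)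
  set π : (ι → Λ) → B → Fin m := fun x v => q (x v)
  have hπ : Measurable π := by fun_prop
  have hlaw : (Measure.infinitePi fun _ : ι => ν).map π = Measure.infinitePi fun _ => ν.map q := by
    rw [← Measure.infinitePi_map_pi (μ := fun _ : B => ν) fun _ => hq,
      ← Measure.map_infinitePi_infinitePi_of_inj (P := fun _ : ι => ν) Subtype.val_injective,
      Measure.map_map (by fun_prop) (by fun_prop)]
    rfl
  have finite := edge_vertex_entropy_le_of_dependsOn (ν := ν.map q) hσ
    (X := fun z => G fun v : s => z ⟨v, hsB v v.2⟩) (T := {v | v.1 ∈ s})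
    (fun z z' h => congrArg G (funext fun v => h _ v.2)) (c := fun v => c v)
    fun a v hv _ => by
      rw [hστ a v hv]
      exact hc a v
  simp only [← hlaw, entropy_map hπ .of_discrete] at finite
  refine finite.trans_eq (Finset.sum_congr rfl fun a _ => congrArg _ (funext fun x => ?_))
  exact Prod.ext rfl (congrArg G (funext fun v => congrArg (q <| x <| Subtype.val ·) (hστ a v v.2)))

theorem edge_vertex_entropy_le (hτ : ∀ a, Function.Involutive (τ a))
    (hc : ∀ a v, c v = some a ∨ c (τ a v) = some a) {F : (ι → Λ) → α} (hF : Measurable F) :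
    (2 * Fintype.card κ - 2) * entropy (Measure.infinitePi fun _ : ι => ν) F ≤
      ∑ a, entropy (Measure.infinitePi fun _ : ι => ν) fun x => (F x, F fun v => x (τ a v)) := by
  set μ := Measure.infinitePi fun _ : ι => ν
  choose F' hF' hμ using fun n : ℕ => exists_isQuantized_measureReal_ne_le (ν := ν) hF
    (ε := 1 / ((n : ℝ) + 1)) (by positivity)
  have hlim : Tendsto (fun n => μ.real {x | F x ≠ F' n x}) atTop (nhds 0) :=
    squeeze_zero (fun _ => measureReal_nonneg) hμ tendsto_one_div_add_atTop_nhds_zero_nat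
  have hshift : ∀ a n, μ.real {x | (F fun v => x (τ a v)) ≠ F' n fun v => x (τ a v)} =
      μ.real {x | F x ≠ F' n x} := fun a n =>
    (measurePreserving_infinitePi_comp ν (hτ a).injective).measureReal_preimage
      (measurableSet_eq_fun hF (hF' n).measurable).compl.nullMeasurableSet
  have hpair : ∀ a, Tendsto (fun n => μ.real {x | (F x, F fun v => x (τ a v)) ≠
      (F' n x, F' n fun v => x (τ a v))}) atTop (nhds 0) := by
    intro a
    refine squeeze_zero (fun _ => measureReal_nonneg) (fun n => ?_) (by simpa using hlim.add hlim)
    refine le_trans (measureReal_mono fun x hx => ?_)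
      ((measureReal_union_le _ _).trans_eq (congrArg _ (hshift a n)))
    exact not_and_or.1 fun h => hx (Prod.ext h.1 h.2)
  exact le_of_tendsto_of_tendsto' ((tendsto_entropy hlim).const_mul _)
    (tendsto_finsetSum _ fun a _ => tendsto_entropy (hpair a))
    fun n => (hF' n).edge_vertex_entropy_le hτ hc

theorem card_mul_sum_le_two_mul_entropy (hτ : ∀ a, Function.Involutive (τ a))
    (hc : ∀ a v, c v = some a ∨ c (τ a v) = some a) {F : (ι → Λ) → α} (hF : Measurable F)
    {E : Finset (α × α)} (hE : ∀ a, ∀ t ∈ E, (Measure.infinitePi fun _ : ι => ν).real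
      ((fun x => (F x, F fun v => x (τ a v))) ⁻¹' {t}) = 0) :
    Fintype.card κ * ∑ t ∈ E, (Measure.infinitePi fun _ : ι => ν).real (F ⁻¹' {t.1}) *
        (Measure.infinitePi fun _ : ι => ν).real (F ⁻¹' {t.2}) ≤
      2 * entropy (Measure.infinitePi fun _ : ι => ν) F := by
  set μ := Measure.infinitePi fun _ : ι => ν
  have hshift : ∀ a b, μ.real ((fun x => F fun v => x (τ a v)) ⁻¹' {b}) = μ.real (F ⁻¹' {b}) :=
    fun a b => (measurePreserving_infinitePi_comp ν (hτ a).injective).measureReal_preimage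
      (hF (measurableSet_singleton b)).nullMeasurableSet
  have hedge : ∀ a, entropy μ (fun x => (F x, F fun v => x (τ a v))) ≤
      2 * entropy μ F - ∑ t ∈ E, μ.real (F ⁻¹' {t.1}) * μ.real (F ⁻¹' {t.2}) := by
    intro a
    have hentropy : entropy μ (fun x => F fun v => x (τ a v)) = entropy μ F :=
      Finset.sum_congr rfl fun b _ => congrArg _ (hshift a b)
    have := entropy_pair_le_of_null hF (Y := fun x => F fun v => x (τ a v)) (by fun_prop) E (hE a)
    simp only [hshift, hentropy] at this
    linarith
  have := (edge_vertex_entropy_le hτ hc hF).trans (Finset.sum_le_sum fun a _ => hedge a)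
  simp only [Finset.sum_const, Finset.card_univ, nsmul_eq_mul] at this
  linarith

end EdgeVertex

section ProductMeasure

theorem infinitePi_map_zip {ι A B : Type*} [MeasurableSpace A] [MeasurableSpace B]
    (μ : ι → Measure A) (ν : ι → Measure B) [∀ i, IsProbabilityMeasure (μ i)]
    [∀ i, IsProbabilityMeasure (ν i)] :
    ((Measure.infinitePi μ).prod (Measure.infinitePi ν)).map (fun p i => (p.1 i, p.2 i)) =
      Measure.infinitePi fun i => (μ i).prod (ν i) := by
  refine IsProjectiveLimit.unique (fun s => ?_) (Measure.isProjectiveLimit_infinitePi _)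
  rw [Measure.map_map (by fun_prop) (by fun_prop),
    ← (measurePreserving_arrowProdEquivProdArrow A B s (fun i => μ i) fun i => ν i).symm.map_eq,
    ← Measure.infinitePi_map_restrict μ, ← Measure.infinitePi_map_restrict ν,
    Measure.map_prod_map _ _ (by fun_prop) (by fun_prop),
    Measure.map_map (MeasurableEquiv.measurable _) (by fun_prop)]
  rfl

theorem infinitePi_map_transpose {ι κ A : Type*} [MeasurableSpace A] (μ : Measure A)
    [IsProbabilityMeasure μ] :
    (Measure.infinitePi fun _ : ι => Measure.infinitePi fun _ : κ => μ).map
      (fun x j i => x i j) = Measure.infinitePi fun _ : κ => Measure.infinitePi fun _ : ι => μ := by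
  rw [← Measure.infinitePi_map_curry (fun (_ : κ) (_ : ι) => μ),
    ← Measure.map_infinitePi_infinitePi_of_inj (P := fun _ : ι × κ => μ)
      (f := Prod.swap) (Prod.swap_injective (α := κ) (β := ι)),
    ← Measure.infinitePi_map_curry_symm (fun (_ : ι) (_ : κ) => μ),
    Measure.map_map (by fun_prop) (by fun_prop), Measure.map_map (by fun_prop) (by fun_prop)]
  rfl

end ProductMeasure

section Sites

open unitInterval in
/-- The Bernoulli law of parameter `p` on truth values: the law of the event `v ∈ S`. -/
def coin (p : unitInterval) : Measure Prop :=
  toNNReal p • Measure.dirac True + toNNReal (σ p) • Measure.dirac False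

instance (p : unitInterval) : IsProbabilityMeasure (coin p) := by
  unfold coin; infer_instance

/-- All the randomness of the coupling at one vertex `v`: the sequence `X₀(v), X₁(v), …` and the
event `v ∈ S`. Regrouping the coupling by vertices turns it into an i.i.d. process on the tree. -/
abbrev Site : Type := (ℕ → unitInterval) × Prop

/-- The law of the randomness of the coupling at one vertex. -/
def siteLaw (p : unitInterval) : Measure Site :=
  (Measure.infinitePi fun _ : ℕ => (volume : Measure unitInterval)).prod (coin p)

instance (p : unitInterval) : IsProbabilityMeasure (siteLaw p) := by
  unfold siteLaw; infer_instance

/-- The law of an i.i.d. family of sites indexed by the vertices. -/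
abbrev sitesLaw (d : ℕ) (p : unitInterval) : Measure (Vertex d → Site) :=
  Measure.infinitePi fun _ => siteLaw p

/-- The randomness of the coupling, regrouped by vertices. -/
def sites {d : ℕ} (ω : (ℕ → Labelling d) × Set (Vertex d)) (v : Vertex d) : Site :=
  (fun i => ω.1 i v, v ∈ ω.2)

open Classical in
/-- The label that a site shows in the `i`-th copy. -/
def siteLabel (i : ℕ) (c : Site) : unitInterval :=
  if c.2 then c.1 i else c.1 0

/-- The labelling of the `i`-th copy as a function of the sites; for `x = sites ω` it is
`copyLabelling ω i`. -/
def siteCopy {d : ℕ} (i : ℕ) (x : Vertex d → Site) : Labelling d := fun v => siteLabel i (x v)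

/-- The set of those among the first `k` copies that contain the root. -/
def rootColor {d : ℕ} (f : Labelling d → Bool) (k : ℕ) (x : Vertex d → Site) : Finset (Fin k) :=
  {j | f (siteCopy (j + 1) x) = true}

theorem measurable_setMem {V : Type*} : Measurable fun (s : Set V) v => v ∈ s :=
  measurable_pi_iff.2 measurable_set_mem

theorem measurable_sites {d : ℕ} : Measurable (sites (d := d)) :=
  measurable_pi_iff.2 fun v =>
    Measurable.prodMk (by fun_prop) ((measurable_set_mem v).comp measurable_snd)

theorem measurable_siteLabel (i : ℕ) : Measurable (siteLabel i) := by
  classical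
  exact Measurable.ite (measurable_snd (.of_discrete (s := {q : Prop | q}))) (by fun_prop)
    (by fun_prop)

theorem measurable_siteCopy {d : ℕ} (i : ℕ) : Measurable (siteCopy (d := d) i) :=
  measurable_pi_iff.2 fun v => (measurable_siteLabel i).comp (measurable_pi_apply v)

theorem setBernoulli_map_setMem {V : Type*} (p : unitInterval) :
    (setBernoulli (Set.univ : Set V) p).map (fun s v => v ∈ s) =
      Measure.infinitePi fun _ => coin p := by
  simp only [setBernoulli_eq_map, Set.mem_univ]
  exact (Measure.map_map measurable_setMem MeasurableEquiv.setOfPred.measurable).trans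
    Measure.map_id

theorem couplingLaw_map_sites (d : ℕ) (p : unitInterval) :
    (couplingLaw d p).map sites = sitesLaw d p := by
  unfold sitesLaw siteLaw
  rw [← infinitePi_map_zip, ← infinitePi_map_transpose, ← setBernoulli_map_setMem,
    Measure.map_prod_map _ _ (by fun_prop) measurable_setMem,
    Measure.map_map (by fun_prop)
      (Measurable.prodMap (by fun_prop) measurable_setMem)]
  rfl

theorem siteLaw_map_siteLabel (p : unitInterval) (i : ℕ) :
    (siteLaw p).map (siteLabel i) = volume := by
  have hcond : ∀ (q : Prop) (j : ℕ), (∀ x, siteLabel i (x, q) = x j) →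
      ((Measure.infinitePi fun _ : ℕ => (volume : Measure unitInterval)).prod
        (Measure.dirac q)).map (siteLabel i) = volume := fun q j h => by
    rw [Measure.prod_dirac, Measure.map_map (measurable_siteLabel i) (by fun_prop)]
    simp only [Function.comp_def, h]
    exact Measure.infinitePi_map_eval _ j
  rw [siteLaw, coin, Measure.prod_add, Measure.prod_smul_right, Measure.prod_smul_right,
    Measure.map_add _ _ (measurable_siteLabel i), Measure.map_smul, Measure.map_smul,
    hcond True i fun _ => if_pos trivial, hcond False 0 fun _ => if_neg not_false,
    ← add_smul, unitInterval.toNNReal_add_toNNReal_symm, one_smul]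

theorem sitesLaw_map_siteCopy (d : ℕ) (p : unitInterval) (i : ℕ) :
    (sitesLaw d p).map (siteCopy i) = labelLaw d := by
  simp only [labelLaw, ← siteLaw_map_siteLabel p i]
  exact Measure.infinitePi_map_pi (μ := fun _ => siteLaw p) fun _ => measurable_siteLabel i

end Sites

section RootColor

variable {d : ℕ} {f : Labelling d → Bool}

theorem head_or_head_flipFun (a : Fin d) (v : Vertex d) :
    v.1.head? = some a ∨ (flipFun a v).1.head? = some a := by
  obtain ⟨l, h⟩ := v
  match l, h with
  | [], _ => simp [flipFun]
  | b :: t, h =>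
    by_cases hb : b = a
    · simp [hb]
    · simp [flipFun, hb]

theorem root_mem_process_iff (hf : IsFactor f) (x : Labelling d) :
    root d ∈ process f x ↔ f x = true :=
  mem_process_iff hf SimpleGraph.Iso.refl rfl x

theorem flipFun_root_mem_process_iff (hf : IsFactor f) (a : Fin d) (x : Labelling d) :
    flipFun a (root d) ∈ process f x ↔ f (fun v => x (flipFun a v)) = true :=
  mem_process_iff hf (edgeFlip a) (flipFun_flipFun a (root d)) x

theorem IsIndepFactor.ae_not_and_flipFun (hf : IsIndepFactor f) (a : Fin d) :
    ∀ᵐ x ∂labelLaw d, ¬ (f x = true ∧ f (fun v => x (flipFun a v)) = true) := by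
  have hadj : (tree d).Adj (root d) (flipFun a (root d)) := Or.inl ⟨a, rfl⟩
  filter_upwards [hf.indep] with x hx
  rw [← root_mem_process_iff hf.toIsFactor, ← flipFun_root_mem_process_iff hf.toIsFactor]
  exact fun ⟨hr, ha⟩ => hx hr ha hadj.ne hadj

theorem mem_rootColor {k : ℕ} {x : Vertex d → Site} {j : Fin k} :
    j ∈ rootColor f k x ↔ f (siteCopy (j + 1) x) = true := by
  simp only [rootColor, Finset.mem_filter, Finset.mem_univ, true_and]

theorem measurableSet_siteCopy_eq_true (hf : Measurable f) (i : ℕ) :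
    MeasurableSet {x : Vertex d → Site | f (siteCopy i x) = true} :=
  hf.comp (measurable_siteCopy i) (.of_discrete (s := {true}))

theorem measurable_rootColor (hf : Measurable f) (k : ℕ) : Measurable (rootColor f k) := by
  refine measurable_finset_iff.2 fun j => ?_
  simp only [mem_rootColor]
  exact measurableSet_setOfPred.1 (measurableSet_siteCopy_eq_true hf _)

theorem IsIndepFactor.real_rootColor_pair_eq_zero (hf : IsIndepFactor f) {k : ℕ} (p : unitInterval)
    (a : Fin d) {S T : Finset (Fin k)} (hST : ¬ Disjoint S T) :
    (sitesLaw d p).real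
      ((fun x => (rootColor f k x, rootColor f k fun v => x (flipFun a v))) ⁻¹' {(S, T)}) = 0 := by
  obtain ⟨j, hS, hT⟩ := Finset.not_disjoint_iff.1 hST
  have hcopy : ∀ᵐ x ∂sitesLaw d p, ¬ (f (siteCopy (j + 1) x) = true ∧
      f (siteCopy (j + 1) fun v => x (flipFun a v)) = true) :=
    ae_of_ae_map (measurable_siteCopy _).aemeasurable
      (sitesLaw_map_siteCopy d p (j + 1) ▸ hf.ae_not_and_flipFun a)
  rw [measureReal_def, measure_mono_null _ (ae_iff.1 hcopy), ENNReal.toReal_zero]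
  intro x hx
  obtain ⟨rfl, rfl⟩ : rootColor f k x = S ∧ _ = T := Prod.mk.inj hx
  exact not_not.2 ⟨mem_rootColor.1 hS, mem_rootColor.1 hT⟩

theorem siteLaw_map_comp (p : unitInterval) {e : ℕ → ℕ} (he : Function.Injective e) :
    (siteLaw p).map (Prod.map (fun x i => x (e i)) id) = siteLaw p := by
  rw [siteLaw, ← Measure.map_prod_map _ _ (by fun_prop) (by fun_prop), Measure.map_id,
    Measure.map_infinitePi_infinitePi_of_inj
      (P := fun _ : ℕ => (volume : Measure unitInterval)) he]

theorem measurableSet_forall_siteCopy (hf : Measurable f) (S : Finset ℕ) :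
    MeasurableSet {x : Vertex d → Site | ∀ j ∈ S, f (siteCopy (j + 1) x) = true} := by
  simp only [Set.ofPred_forall]
  exact MeasurableSet.biInter (Finset.countable_toSet S) fun j _ =>
    measurableSet_siteCopy_eq_true hf (j + 1)

theorem interDensity_eq (hf : IsFactor f) (p : unitInterval) (i : ℕ) :
    interDensity f p i =
      (sitesLaw d p).real {x | ∀ j ∈ Finset.range i, f (siteCopy (j + 1) x) = true} := by
  rw [← couplingLaw_map_sites, interDensity, map_measureReal_apply measurable_sites
    (measurableSet_forall_siteCopy hf.measurable _)]
  congr 1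
  ext ω
  have hrange : (∀ j ∈ Finset.Icc 1 i, f (copyLabelling ω j) = true) ↔
      ∀ j ∈ Finset.range i, f (copyLabelling ω (j + 1)) = true := by
    simp only [Finset.mem_Icc, Finset.mem_range]
    exact ⟨fun h j hj => h (j + 1) ⟨by lia, by lia⟩, fun h j hj => by
      simpa only [Nat.sub_add_cancel hj.1] using h (j - 1) (by lia)⟩
  simp only [Set.mem_iInter, Set.mem_ofPred_eq, copy, root_mem_process_iff hf, hrange]
  rfl

theorem exists_perm_map_range_card_eq (S : Finset ℕ) :
    ∃ g : Equiv.Perm ℕ, (Finset.range S.card).map g.toEmbedding = S := by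
  classical
  have := Set.powersetCard.isPretransitive (α := ℕ) (n := S.card)
  obtain ⟨g, hg⟩ := MulAction.exists_smul_eq (Equiv.Perm ℕ)
    (⟨Finset.range S.card, Finset.card_range _⟩ : Set.powersetCard ℕ S.card) ⟨S, rfl⟩
  refine ⟨g, ?_⟩
  rw [Finset.map_eq_image]
  exact congrArg Subtype.val hg

theorem real_forall_siteCopy (hf : IsFactor f) (p : unitInterval) (S : Finset ℕ) :
    (sitesLaw d p).real {x | ∀ j ∈ S, f (siteCopy (j + 1) x) = true} =
      interDensity f p S.card := by
  obtain ⟨g, hg⟩ := exists_perm_map_range_card_eq S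
  -- The copies are renumbered by `g`, while the common labelling `X₀` stays in place.
  let e : ℕ → ℕ := fun n => n.casesOn 0 fun j => g j + 1
  have he : Function.Injective e := by
    rintro (_ | m) (_ | n) h <;> simp_all [e]
  let r : Site → Site := Prod.map (fun x i => x (e i)) id
  have hr : (sitesLaw d p).map (fun x v => r (x v)) = sitesLaw d p := by
    rw [sitesLaw, Measure.infinitePi_map_pi (μ := fun _ => siteLaw p) fun _ => by fun_prop]
    simp only [r, siteLaw_map_comp p he]
  have hcopy : ∀ j (x : Vertex d → Site),
      siteCopy (j + 1) (fun v => r (x v)) = siteCopy (g j + 1) x := fun _ _ => rfl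
  calc (sitesLaw d p).real {x | ∀ j ∈ S, f (siteCopy (j + 1) x) = true}
    _ = (sitesLaw d p).real ((fun x v => r (x v)) ⁻¹'
          {x | ∀ j ∈ Finset.range S.card, f (siteCopy (j + 1) x) = true}) := by
        conv_lhs => rw [← hg]
        simp only [Set.preimage_ofPred_eq, hcopy, Finset.forall_mem_map, Equiv.coe_toEmbedding]
    _ = interDensity f p S.card := by
        rw [← map_measureReal_apply (by fun_prop) (measurableSet_forall_siteCopy hf.measurable _),
          hr, interDensity_eq hf]

theorem real_subset_rootColor (hf : IsFactor f) (p : unitInterval) {k : ℕ} (T : Finset (Fin k)) :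
    (sitesLaw d p).real {x | T ⊆ rootColor f k x} = interDensity f p T.card := by
  rw [← Finset.card_map Fin.valEmbedding, ← real_forall_siteCopy hf]
  simp only [Finset.forall_mem_map, Finset.subset_iff, mem_rootColor]
  rfl

end RootColor

section InclusionExclusion

variable {ι J : Type*} [Fintype ι]

theorem sum_neg_one_pow_card_mul_sum_subset [DecidableEq ι] [Fintype J]
    (A : J → Finset ι) (w : J → ℝ) :
    ∑ T : Finset ι, (-1 : ℝ) ^ T.card * ∑ j with T ⊆ A j, w j = ∑ j with A j = ∅, w j := by
  have hpowerset : ∀ S : Finset ι,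
      ∑ T with T ⊆ S, (-1 : ℝ) ^ T.card = if S = ∅ then 1 else 0 := fun S => by
    rw [Finset.filter_subset_univ]
    exact_mod_cast congrArg (Int.cast : ℤ → ℝ)
      (Finset.sum_powerset_neg_one_pow_card (x := S))
  calc ∑ T : Finset ι, (-1 : ℝ) ^ T.card * ∑ j with T ⊆ A j, w j
    _ = ∑ j, (∑ T with T ⊆ A j, (-1 : ℝ) ^ T.card) * w j := by
        simp only [Finset.sum_filter, Finset.mul_sum, Finset.sum_mul, mul_ite, ite_mul, mul_zero,
          zero_mul]
        exact Finset.sum_comm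
    _ = ∑ j with A j = ∅, w j := by
        simp only [hpowerset, ite_mul, one_mul, zero_mul, Finset.sum_filter]

theorem sum_Icc_neg_one_pow_mul_choose_mul (g : ℕ → ℝ) :
    ∑ i ∈ Finset.Icc 1 (Fintype.card ι),
        (-1 : ℝ) ^ (i - 1) * ((Fintype.card ι).choose i : ℝ) * g i =
      g 0 - ∑ T : Finset ι, (-1 : ℝ) ^ T.card * g T.card := by
  have hcard := Finset.sum_powerset_apply_card (fun i => (-1 : ℝ) ^ i * g i)
    (x := (Finset.univ : Finset ι))
  rw [Finset.powerset_univ, Finset.card_univ, Finset.sum_range_succ'] at hcard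
  rw [hcard, ← Finset.Ico_add_one_right_eq_Icc, Finset.sum_Ico_eq_sum_range]
  simp only [Nat.add_sub_cancel, add_comm 1, pow_succ, nsmul_eq_mul,
    Nat.choose_zero_right, pow_zero, Nat.cast_one, one_mul, sub_add_cancel_right,
    ← Finset.sum_neg_distrib]
  exact Finset.sum_congr rfl fun i _ => by ring

/-- Inclusion–exclusion turns `∑ (-1)^|T| a` into the weight of `∅`, and `∑ (-1)^|T| a²` into the
weight of the disjoint pairs. -/
theorem sum_choose_mul_two_sub [DecidableEq ι] {β : Finset ι → ℝ} {a : ℕ → ℝ}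
    (ha : ∀ T : Finset ι, a T.card = ∑ S with T ⊆ S, β S) :
    ∑ i ∈ Finset.Icc 1 (Fintype.card ι),
        (-1 : ℝ) ^ (i - 1) * ((Fintype.card ι).choose i : ℝ) * (a i * (2 - a i)) =
      2 * ∑ S ∈ {∅}ᶜ, β S - ∑ q : Finset ι × Finset ι with ¬ Disjoint q.1 q.2, β q.1 * β q.2 := by
  have hzero : a 0 = ∑ S, β S := by simpa using ha ∅
  have hsq : ∀ T : Finset ι, a T.card ^ 2 =
      ∑ q : Finset ι × Finset ι with T ⊆ q.1 ∩ q.2, β q.1 * β q.2 := fun T => by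
    rw [ha, sq, Finset.sum_mul_sum, ← Finset.sum_product', ← Finset.filter_product,
      Finset.univ_product_univ]
    simp only [Finset.subset_inter_iff]
  have hlinear : ∑ T : Finset ι, (-1 : ℝ) ^ T.card * a T.card = β ∅ := by
    simp only [ha]
    rw [sum_neg_one_pow_card_mul_sum_subset (fun S => S), Finset.filter_eq',
      if_pos (Finset.mem_univ _), Finset.sum_singleton]
  have hquad : ∑ T : Finset ι, (-1 : ℝ) ^ T.card * a T.card ^ 2 =
      ∑ q : Finset ι × Finset ι with Disjoint q.1 q.2, β q.1 * β q.2 := by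
    simp only [hsq, Finset.disjoint_iff_inter_eq_empty]
    exact sum_neg_one_pow_card_mul_sum_subset (fun q : Finset ι × Finset ι => q.1 ∩ q.2) _
  have hpairs : (∑ S, β S) ^ 2 =
      ∑ q : Finset ι × Finset ι with Disjoint q.1 q.2, β q.1 * β q.2 +
        ∑ q : Finset ι × Finset ι with ¬ Disjoint q.1 q.2, β q.1 * β q.2 := by
    rw [Finset.sum_filter_add_sum_filter_not, sq, Finset.sum_mul_sum, Fintype.sum_prod_type]
  have hsplit : ∑ S, β S = β ∅ + ∑ S ∈ {∅}ᶜ, β S := Fintype.sum_eq_add_sum_compl ∅ β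
  have hexpand : ∑ T : Finset ι, (-1 : ℝ) ^ T.card * (a T.card * (2 - a T.card)) =
      2 * ∑ T : Finset ι, (-1 : ℝ) ^ T.card * a T.card -
        ∑ T : Finset ι, (-1 : ℝ) ^ T.card * a T.card ^ 2 := by
    rw [Finset.mul_sum, ← Finset.sum_sub_distrib]
    exact Finset.sum_congr rfl fun T _ => by ring
  rw [sum_Icc_neg_one_pow_mul_choose_mul fun i => a i * (2 - a i), hexpand, hlinear, hquad, hzero]
  linarith

end InclusionExclusion

section NormalizedDensities

variable {α : Type*} [Fintype α] {β : α → ℝ}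

theorem sum_negMulLog_mul_le [DecidableEq α] (hβ : ∀ s, 0 ≤ β s) {c L : ℝ} (hc : 0 < c)
    (hL : -Real.log c ≤ L) (hsum : ∑ s, c * β s = 1) (o : α) :
    ∑ s, Real.negMulLog (c * β s) ≤
      c * (L * ∑ s ∈ {o}ᶜ, β s + Fintype.card α + ∑ s ∈ {o}ᶜ, β s) := by
  have hmain : Real.negMulLog (c * β o) ≤ c * ∑ s ∈ {o}ᶜ, β s := by
    rw [Fintype.sum_eq_add_sum_compl o, ← Finset.mul_sum] at hsum
    linarith [Real.negMulLog_le_one_sub_self (mul_nonneg hc.le (hβ o))]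
  have hrare : ∀ s, Real.negMulLog (c * β s) ≤ c * (L * β s + 1) := fun s => by
    have hone : Real.negMulLog (β s) ≤ 1 :=
      (Real.negMulLog_le_one_sub_self (hβ s)).trans (sub_le_self _ (hβ s))
    have hlog : Real.negMulLog c ≤ c * L := by
      rw [Real.negMulLog, neg_mul_comm]
      exact mul_le_mul_of_nonneg_left hL hc.le
    rw [Real.negMulLog_mul]
    linarith [mul_le_mul_of_nonneg_left hlog (hβ s), mul_le_mul_of_nonneg_left hone hc.le]
  have hcard : ((({o}ᶜ : Finset α).card : ℕ) : ℝ) ≤ Fintype.card α :=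
    Nat.cast_le.2 (Finset.card_le_univ _)
  calc ∑ s, Real.negMulLog (c * β s)
    _ = Real.negMulLog (c * β o) + ∑ s ∈ {o}ᶜ, Real.negMulLog (c * β s) :=
        Fintype.sum_eq_add_sum_compl o _
    _ ≤ c * ∑ s ∈ {o}ᶜ, β s + ∑ s ∈ {o}ᶜ, c * (L * β s + 1) :=
        add_le_add hmain (Finset.sum_le_sum fun s _ => hrare s)
    _ = c * (L * ∑ s ∈ {o}ᶜ, β s + ({o}ᶜ : Finset α).card + ∑ s ∈ {o}ᶜ, β s) := by
        rw [← Finset.mul_sum, Finset.sum_add_distrib, ← Finset.mul_sum, Finset.sum_const,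
          nsmul_one]
        ring
    _ ≤ _ := by gcongr

theorem sq_sum_le_card_mul_sum_pairs (hβ : ∀ s, 0 ≤ β s) {A : Finset α} {E : Finset (α × α)}
    (hE : ∀ s ∈ A, (s, s) ∈ E) :
    (∑ s ∈ A, β s) ^ 2 ≤ Fintype.card α * ∑ q ∈ E, β q.1 * β q.2 := by
  have hdiag : ∑ s ∈ A, β s ^ 2 ≤ ∑ q ∈ E, β q.1 * β q.2 := by
    calc ∑ s ∈ A, β s ^ 2
      _ = ∑ q ∈ A.diag, β q.1 * β q.2 := by simp only [Finset.sum_diag, sq]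
      _ ≤ _ := by
          refine Finset.sum_le_sum_of_subset_of_nonneg (fun q hq => ?_)
            fun q _ _ => mul_nonneg (hβ q.1) (hβ q.2)
          obtain ⟨hmem, heq⟩ := Finset.mem_diag.1 hq
          exact (Prod.ext rfl heq : (q.1, q.1) = q) ▸ hE q.1 hmem
  exact sq_sum_le_card_mul_sum_sq.trans (mul_le_mul (Nat.cast_le.2 (Finset.card_le_univ A)) hdiag
    (Finset.sum_nonneg fun _ _ => sq_nonneg _) (Nat.cast_nonneg _))

/-- The hypotheses force `U ≤ 5N`: otherwise `U²` outgrows the linear bound for `NQ`. -/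
theorem neg_div_le_two_mul_sub {L N Q U : ℝ} (hL : 1 ≤ L) (hN : 0 < N) (hU : 0 ≤ U)
    (hUQ : U ^ 2 ≤ N * Q) (hLQ : L * Q ≤ 2 * (L * U + N + U)) :
    -(12 * N) / L ≤ 2 * U - Q := by
  have hL0 : 0 < L := by linarith
  have hQ : Q ≤ 4 * U + 2 * N :=
    le_of_mul_le_mul_left (by nlinarith : L * Q ≤ L * (4 * U + 2 * N)) hL0
  have hUN : U ≤ 5 * N := by
    by_contra! hlt
    nlinarith
  rw [div_le_iff₀ hL0]
  linarith

theorem neg_div_log_le_two_mul_sum_sub_sum [DecidableEq α] (hβ : ∀ s, 0 ≤ β s) {d : ℝ}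
    (hd : 0 < d) (hlog : 1 ≤ Real.log d) (hsum : ∑ s, Real.log d / d * β s = 1) (o : α)
    {E : Finset (α × α)} (hE : ∀ s, s ≠ o → (s, s) ∈ E)
    (h : d * ∑ q ∈ E, (Real.log d / d * β q.1) * (Real.log d / d * β q.2) ≤
      2 * ∑ s, Real.negMulLog (Real.log d / d * β s)) :
    -(12 * Fintype.card α) / Real.log d ≤ 2 * ∑ s ∈ {o}ᶜ, β s - ∑ q ∈ E, β q.1 * β q.2 := by
  have hc : 0 < Real.log d / d := div_pos (by linarith) hd
  have hlogc : -Real.log (Real.log d / d) ≤ Real.log d := by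
    rw [Real.log_div (by linarith) hd.ne']
    linarith [Real.log_nonneg hlog]
  refine neg_div_le_two_mul_sub hlog (Nat.cast_pos.2 (Fintype.card_pos_iff.2 ⟨o⟩))
    (Finset.sum_nonneg fun s _ => hβ s)
    (sq_sum_le_card_mul_sum_pairs hβ fun s hs =>
      hE s (Finset.notMem_singleton.1 (Finset.mem_compl.1 hs)))
    (le_of_mul_le_mul_left ?_ hc)
  calc Real.log d / d * (Real.log d * ∑ q ∈ E, β q.1 * β q.2)
    _ = d * ∑ q ∈ E, (Real.log d / d * β q.1) * (Real.log d / d * β q.2) := by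
        simp only [mul_mul_mul_comm _ (β _), ← Finset.mul_sum]
        field_simp
    _ ≤ 2 * ∑ s, Real.negMulLog (Real.log d / d * β s) := h
    _ ≤ 2 * (Real.log d / d * _) :=
        mul_le_mul_of_nonneg_left (sum_negMulLog_mul_le hβ hc hlogc hsum o) zero_le_two
    _ = _ := mul_left_comm _ _ _

end NormalizedDensities

section AlternatingSum

variable {d : ℕ} {f : Labelling d → Bool}

theorem alpha_card_eq_sum (hf : IsFactor f) (p : unitInterval) {k : ℕ} (T : Finset (Fin k)) :
    alpha f p T.card = ∑ S with T ⊆ S,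
      (sitesLaw d p).real (rootColor f k ⁻¹' {S}) / (Real.log d / d) := by
  rw [alpha, ← real_subset_rootColor hf, ← Finset.sum_div, sum_measureReal_preimage_singleton _
    fun S _ => measurable_rootColor hf.measurable k (measurableSet_singleton S)]
  simp only [Finset.coe_filter, Finset.mem_univ, true_and, Set.preimage_ofPred_eq]

theorem IsIndepFactor.mul_sum_not_disjoint_le (hf : IsIndepFactor f) (p : unitInterval) (k : ℕ) :
    d * ∑ q : Finset (Fin k) × Finset (Fin k) with ¬ Disjoint q.1 q.2,
        (sitesLaw d p).real (rootColor f k ⁻¹' {q.1}) *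
          (sitesLaw d p).real (rootColor f k ⁻¹' {q.2}) ≤
      2 * entropy (sitesLaw d p) (rootColor f k) := by
  simpa only [Fintype.card_fin] using card_mul_sum_le_two_mul_entropy flipFun_flipFun
    head_or_head_flipFun (measurable_rootColor hf.measurable k) fun a _ hq =>
      hf.real_rootColor_pair_eq_zero p a (Finset.mem_filter.1 hq).2

theorem alternating_sum_ge (hf : IsIndepFactor f) (k : ℕ) (p : unitInterval)
    (hlog : 1 ≤ Real.log d) :
    -(12 * Fintype.card (Finset (Fin k))) / Real.log d ≤
      ∑ i ∈ Finset.Icc 1 k, (-1 : ℝ) ^ (i - 1) * (k.choose i : ℝ) *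
        (alpha f p i * (2 - alpha f p i)) := by
  have hd : (0 : ℝ) < d :=
    (Nat.cast_nonneg d).lt_of_ne fun h => by simp [← h] at hlog; linarith
  have hc : Real.log d / d ≠ 0 := (div_pos (by linarith) hd).ne'
  have hsum : ∑ S, (sitesLaw d p).real (rootColor f k ⁻¹' {S}) = 1 :=
    (sum_real_preimage_singleton (measurable_rootColor hf.measurable k)).trans probReal_univ
  have hbound := neg_div_log_le_two_mul_sum_sub_sum
    (β := fun S => (sitesLaw d p).real (rootColor f k ⁻¹' {S}) / (Real.log d / d))
    (E := {q | ¬ Disjoint q.1 q.2}) (o := ∅)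
    (fun S => div_nonneg measureReal_nonneg (div_pos (by linarith) hd).le) hd hlog
    (by simpa only [mul_div_cancel₀ _ hc] using hsum)
    (fun S hS => Finset.mem_filter.2 ⟨Finset.mem_univ _, fun h => hS (disjoint_self.1 h)⟩)
    (by simpa only [entropy, mul_div_cancel₀ _ hc] using hf.mul_sum_not_disjoint_le p k)
  have hexpand := sum_choose_mul_two_sub (alpha_card_eq_sum hf.toIsFactor p (k := k))
  rw [Fintype.card_fin] at hexpand
  exact hbound.trans_eq hexpand.symm

end AlternatingSum

end FIID

end

theorem theorem2p2 (f : (d : ℕ) → FIID.Labelling d → Bool)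
    (hf : ∀ d, FIID.IsIndepFactor (f d)) (k : ℕ) (hk : 1 ≤ k) :
    (0 : EReal) ≤ Filter.liminf (fun d : ℕ => ⨅ p : unitInterval,
      ((∑ i ∈ Finset.Icc 1 k, (-1 : ℝ) ^ (i - 1) * (k.choose i : ℝ) *
        (FIID.alpha (f d) p i * (2 - FIID.alpha (f d) p i)) : ℝ) : EReal)) Filter.atTop := by
  have hlog : Tendsto (fun d : ℕ => Real.log d) atTop atTop :=
    Real.tendsto_log_atTop.comp tendsto_natCast_atTop_atTop
  have hlim : Tendsto (fun d : ℕ => ((-(12 * Fintype.card (Finset (Fin k))) / Real.log d : ℝ) :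
      EReal)) atTop (nhds ((0 : ℝ) : EReal)) :=
    (continuous_coe_real_ereal.tendsto 0).comp (hlog.const_div_atTop _)
  rw [← EReal.coe_zero, ← hlim.liminf_eq]
  refine liminf_le_liminf ?_
  filter_upwards [hlog.eventually_ge_atTop 1] with d hd
  exact le_iInf fun p => EReal.coe_le_coe_iff.2 (FIID.alternating_sum_ge (hf d) k p hd)
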